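/- For each $n \ge 1$ let $\{\eta_{n,v} : v \in V_n\}$ be a mean zero (jointly) Gaussian field indexed by a finite set $V_n$, and let $g_n(V_n) = \mathbb{E}[\max_{v \in V_n} \eta_{n,v}]$. Fix $\lambda > 1$. Call the sequence of fields extremal (with parameter $\lambda$) if $\operatorname{Var}(\eta_{n,v}) \le n$ for all $v \in V_n$, $n^{-1}\log|V_n| \to \log\lambda$, and $$\lim_{n\to\infty} \frac{g_n(V_n)}{n\sqrt{2\log\lambda}} = 1 .$$ Every extremal sequence with parameter $\lambda$ has the following two properties. (1) (Multiple valleys.) For all $\delta, \epsilon > 0$ there is $c = c(\delta,\epsilon,\lambda) > 0$, depending only on $\delta,\epsilon,\lambda$ and not on the sequence of fields, such that with probability tending to one as $n \to \infty$ there exists a (random) set $W_n \subseteq V_n$ with (a) $|W_n| \ge e^{cn}$; (b) $\mathbb{E}(\eta_{n,v}\eta_{n,u}) \le \epsilon \sqrt{\operatorname{Var}(\eta_{n,v})\operatorname{Var}(\eta_{n,u})}$ for all distinct $u, v \in W_n$; (c) $\eta_{n,v} \ge g_n(V_n) - \delta n$ for all $v \in W_n$. (2) (Size of level sets.) For every fixed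 $0 < \alpha < 1$, the level set $U_{n,\alpha} = \{v \in V_n : \eta_{n,v} \ge \alpha\, g_n(V_n)\}$ satisfies $$\frac{\log|U_{n,\alpha}|}{\log|V_n|} \to 1 - \alpha^2 \quad \text{in probability as } n \to \infty .$$ -/

import Mathlib

open MeasureTheory ProbabilityTheory Filter Topology

/-- A mean zero Gaussian field `{X v : v ∈ V}` on the probability space `(Ω, P)`: all finite
dimensional marginals are jointly Gaussian (possibly degenerate), and all means vanish. -/
structure IsCenteredGaussianField {Ω V : Type*} [MeasurableSpace Ω]
    (P : Measure Ω) (X : V → Ω → ℝ) : Prop where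
  gaussian : IsGaussianProcess X P
  mean_zero : ∀ v, ∫ ω, X v ω ∂P = 0

/-- The expected maximum `g(V) = E [sup_{v ∈ V} X v]` of a field over a finite index set. -/
noncomputable def expMax {Ω V : Type*} [MeasurableSpace Ω]
    (P : Measure Ω) (X : V → Ω → ℝ) : ℝ :=
  ∫ ω, (⨆ v, X v ω) ∂P

/-- The random level set `U_α(ω) = {v ∈ V : X v ω ≥ α g(V)}`. -/
noncomputable def levelSet {Ω V : Type*} [MeasurableSpace Ω] [Fintype V]
    (P : Measure Ω) (X : V → Ω → ℝ) (α : ℝ) (ω : Ω) : Finset V :=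
  Finset.univ.filter fun v => α * expMax P X ≤ X v ω

/-- Convergence in probability to a constant, the `n`-th variable living on its own
probability space. -/
def TendstoInProbConst {Ω : ℕ → Type*} [∀ n, MeasurableSpace (Ω n)]
    (P : ∀ n, Measure (Ω n)) (Y : ∀ n, Ω n → ℝ) (a : ℝ) : Prop :=
  ∀ r : ℝ, 0 < r → Tendsto (fun n => P n {ω | r ≤ |Y n ω - a|}) atTop (𝓝 0)

/-- A sequence of fields `η n = {η n v : v ∈ V n}` is extremal with parameter `lam`: it consists of
mean zero Gaussian fields with variances at most `n`, `n⁻¹ log |V n| → log lam`, and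
`g_n(V n) / (n √(2 log lam)) → 1`. (The variance bound is not imposed at `n = 0`.) -/
structure IsExtremal {Ω V : ℕ → Type*} [∀ n, MeasurableSpace (Ω n)] [∀ n, Fintype (V n)]
    (P : ∀ n, Measure (Ω n)) (η : ∀ n, V n → Ω n → ℝ) (lam : ℝ) : Prop where
  field : ∀ n, IsCenteredGaussianField (P n) (η n)
  variance_le : ∀ n, 1 ≤ n → ∀ v, variance (η n v) (P n) ≤ n
  card_growth :
    Tendsto (fun n : ℕ => Real.log (Fintype.card (V n)) / n) atTop (𝓝 (Real.log lam))
  expMax_growth :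
    Tendsto (fun n : ℕ => expMax (P n) (η n) / (n * Real.sqrt (2 * Real.log lam))) atTop (𝓝 1)

/-- `W` is a set of valleys for the outcome `ω` of the field `X` at stage `n`, with parameters
`c, δ, ε`: it has at least `exp (c n)` elements, distinct elements have correlation at most `ε`,
and all its elements are within `δ n` of the expected maximum. -/
structure IsValleySet {Ω V : Type*} [MeasurableSpace Ω]
    (P : Measure Ω) (X : V → Ω → ℝ) (n : ℕ) (c δ ε : ℝ) (ω : Ω) (W : Finset V) : Prop where
  card_ge : Real.exp (c * n) ≤ (W.card : ℝ)
  nearly_orthogonal : ∀ u ∈ W, ∀ v ∈ W, u ≠ v →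
    ∫ ω', X v ω' * X u ω' ∂P ≤ ε * Real.sqrt (variance (X v) P * variance (X u) P)
  high : ∀ v ∈ W, expMax P X - δ * n ≤ X v ω

/-- The sequence of fields exhibits multiple valleys, with constants `c δ ε > 0`: for all
`δ, ε > 0`, with probability tending to one there is a (random) set `W ⊆ V n` of valleys. -/
def ExhibitsMultipleValleys {Ω V : ℕ → Type*} [∀ n, MeasurableSpace (Ω n)]
    (P : ∀ n, Measure (Ω n)) (η : ∀ n, V n → Ω n → ℝ) (c : ℝ → ℝ → ℝ) : Prop :=
  ∀ δ ε : ℝ, 0 < δ → 0 < ε → 0 < c δ ε ∧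
    Tendsto (fun n => P n {ω | ∃ W : Finset (V n), IsValleySet (P n) (η n) n (c δ ε) δ ε ω W})
      atTop (𝓝 1)

/-! Write m = √(2 log lam), so that |V n| is about exp(m²n/2) and the expected maximum about mn.
Rotate two independent copies x, y of the field: cos φ · x + sin φ · y has the law of the field
(`map_cos_add_sin_eq_self`), so it reaches almost mn at some v. A Chernoff bound and a union over V
n show that wherever this happens, x v and y v cannot fall much short of their shares mn cos φ and
mn sin φ (`prod_measureReal_not_exists_pair_le`). By Fubini, for typical x the copy y reaches about
mn sin φ on the level set of x at height about mn cos φ, with probability above 1/2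
(`tendsto_measureReal_of_section`).

A level set with rate well below (m²/2) sin² φ would violate this by a union bound; with cos φ near
α this is the lower bound on the level set. The upper bound is a first moment.

For valleys take φ small, so that mn cos φ is within δn of the maximum. A maximal nearly orthogonal
W inside the level set covers it by correlation balls. If W were small, y on W would be negligible,
and subtracting from y v a multiple of y w for a correlated w in W would reduce the variance by the
factor 1 - ε² (`measureReal_exists_coord_ge_le_of_cover`). The maximum of y on the level set would
then be too low, so W is exponentially large. -/

section FiniteDimensional

/-- Chernoff's bound in the form of Markov's inequality for `exp ∘ f`. -/
theorem measureReal_le_integral_exp {Ω : Type*} [MeasurableSpace Ω] {P : Measure Ω}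
    [IsFiniteMeasure P] {f : Ω → ℝ} (hf : Integrable (fun x => Real.exp (f x)) P) {S : Set Ω}
    (hS : ∀ x ∈ S, 0 ≤ f x) : P.real S ≤ ∫ x, Real.exp (f x) ∂P := by
  have h := mul_meas_ge_le_integral_of_nonneg (μ := P) (f := fun x => Real.exp (f x))
    (ae_of_all _ fun x => (Real.exp_pos _).le) hf 1
  rw [one_mul] at h
  refine le_trans (measureReal_mono fun x hx => ?_) h
  exact Real.one_le_exp (hS x hx)

/-! ### Exponential moments and tails of a centred Gaussian measure. -/

variable {V : Type*} [Fintype V] {μ : Measure (V → ℝ)}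

theorem integral_dual_eq_zero_of_coord [IsGaussian μ] (h0 : ∀ v, ∫ x, x v ∂μ = 0)
    (L : StrongDual ℝ (V → ℝ)) : ∫ x, L x ∂μ = 0 := by
  have hid : ∫ x, x ∂μ = 0 := by
    ext v
    have := (ContinuousLinearMap.proj (R := ℝ) (φ := fun _ : V => ℝ) v).integral_comp_comm
      (IsGaussian.integrable_id (μ := μ))
    simp only [id_eq, ContinuousLinearMap.proj_apply] at this
    rw [← this]
    simpa using h0 v
  rw [IsGaussian.integral_dual, hid, map_zero]

theorem integrable_exp_dual [IsGaussian μ] (L : StrongDual ℝ (V → ℝ)) :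
    Integrable (fun x => Real.exp (L x)) μ := by
  have h := integrable_exp_mul_gaussianReal (μ := μ[L]) (v := (Var[L; μ]).toNNReal) 1
  rw [← IsGaussian.map_eq_gaussianReal, integrable_map_measure (by fun_prop) (by fun_prop)] at h
  simpa [Function.comp_def] using h

theorem integral_exp_dual [IsGaussian μ] (h0 : ∀ v, ∫ x, x v ∂μ = 0)
    (L : StrongDual ℝ (V → ℝ)) : ∫ x, Real.exp (L x) ∂μ = Real.exp (Var[L; μ] / 2) := by
  have h := mgf_gaussianReal (X := L) (IsGaussian.map_eq_gaussianReal (μ := μ) L) 1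
  simp only [mgf, one_mul, integral_dual_eq_zero_of_coord h0, mul_one, one_pow, zero_add,
    Real.coe_toNNReal _ (variance_nonneg _ _)] at h
  exact h

theorem measureReal_dual_ge_le [IsGaussian μ] (h0 : ∀ v, ∫ x, x v ∂μ = 0)
    (L : StrongDual ℝ (V → ℝ)) {s t : ℝ} (hs : 0 < s) (hL : Var[L; μ] ≤ s) (ht : 0 ≤ t) :
    μ.real {x | t ≤ L x} ≤ Real.exp (-t ^ 2 / (2 * s)) := by
  have hint := integrable_exp_dual (μ := μ) ((t / s) • L)
  have heq : ∀ x, Real.exp (((t / s) • L) x - t ^ 2 / s)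
      = Real.exp (((t / s) • L) x) * Real.exp (-(t ^ 2 / s)) := fun x => by
    rw [← Real.exp_add, sub_eq_add_neg]
  refine (measureReal_le_integral_exp (f := fun x => ((t / s) • L) x - t ^ 2 / s) ?_ ?_).trans ?_
  · simp_rw [heq]
    exact hint.mul_const _
  · intro x hx
    have hx' : t ≤ L x := hx
    have : t / s * t ≤ t / s * L x := mul_le_mul_of_nonneg_left hx' (by positivity)
    simp only [smul_apply, smul_eq_mul]
    have h2 : t ^ 2 / s = t / s * t := by ring
    linarith
  · simp_rw [heq]
    rw [integral_mul_const, integral_exp_dual h0, ← Real.exp_add]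
    apply Real.exp_le_exp.mpr
    have : Var[((t / s) • L : StrongDual ℝ (V → ℝ)); μ] = (t / s) ^ 2 * Var[L; μ] := by
      rw [← variance_smul]; rfl
    rw [this]
    have h2 : (t / s) ^ 2 * Var[L; μ] ≤ (t / s) ^ 2 * s :=
      mul_le_mul_of_nonneg_left hL (by positivity)
    have h3 : (t / s) ^ 2 * s = t ^ 2 / s := by field_simp
    have h4 : -t ^ 2 / (2 * s) = -(t ^ 2 / s) / 2 := by field_simp
    rw [h4]; linarith

theorem measureReal_coord_ge_le [IsGaussian μ] (h0 : ∀ v, ∫ x, x v ∂μ = 0)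
    {v : V} {s t : ℝ} (hs : 0 < s) (hv : Var[fun x => x v; μ] ≤ s) (ht : 0 ≤ t) :
    μ.real {x | t ≤ x v} ≤ Real.exp (-t ^ 2 / (2 * s)) :=
  measureReal_dual_ge_le h0 (ContinuousLinearMap.proj (R := ℝ) (φ := fun _ : V => ℝ) v) hs hv ht

theorem measureReal_exists_coord_ge_le [IsGaussian μ] (h0 : ∀ v, ∫ x, x v ∂μ = 0)
    {s t : ℝ} (hs : 0 < s) (hv : ∀ v, Var[fun x => x v; μ] ≤ s) (ht : 0 ≤ t) (U : Finset V) :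
    μ.real {x | ∃ v ∈ U, t ≤ x v} ≤ U.card * Real.exp (-t ^ 2 / (2 * s)) := by
  have : {x : V → ℝ | ∃ v ∈ U, t ≤ x v} = ⋃ v ∈ U, {x | t ≤ x v} := by ext; simp
  rw [this]
  refine (measureReal_biUnion_finset_le _ _).trans ?_
  rw [← nsmul_eq_mul]
  exact Finset.sum_le_card_nsmul _ _ _ fun v _ => measureReal_coord_ge_le h0 hs (hv v) ht

/-- First moment bound for the size of a level set. -/
theorem measureReal_card_ge_le [IsGaussian μ] (h0 : ∀ v, ∫ x, x v ∂μ = 0)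
    {s t K : ℝ} (hs : 0 < s) (hv : ∀ v, Var[fun x => x v; μ] ≤ s) (ht : 0 ≤ t) (hK : 0 < K) :
    μ.real {x | K ≤ ((Finset.univ.filter fun v => t ≤ x v).card : ℝ)} ≤
      Fintype.card V * Real.exp (-t ^ 2 / (2 * s)) / K := by
  have hmeas : ∀ v, MeasurableSet {x : V → ℝ | t ≤ x v} := fun v =>
    measurableSet_le measurable_const (measurable_pi_apply v)
  have hcard : ∀ x : V → ℝ, ((Finset.univ.filter fun v => t ≤ x v).card : ℝ)
      = ∑ v, {x : V → ℝ | t ≤ x v}.indicator (fun _ => (1 : ℝ)) x := fun x => by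
    simp [Set.indicator_apply]
  have hind : ∀ v, Integrable ({x : V → ℝ | t ≤ x v}.indicator (fun _ => (1 : ℝ))) μ := fun v =>
    (integrable_const _).indicator (hmeas v)
  have h := mul_meas_ge_le_integral_of_nonneg (μ := μ)
    (f := fun x => ((Finset.univ.filter fun v => t ≤ x v).card : ℝ))
    (ae_of_all _ fun x => by positivity)
    (by simp_rw [hcard]; exact integrable_finsetSum _ fun v _ => hind v) K
  rw [le_div_iff₀ hK, mul_comm]
  refine h.trans ?_
  simp_rw [hcard]
  rw [integral_finsetSum _ fun v _ => hind v, ← nsmul_eq_mul]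
  refine Finset.sum_le_card_nsmul _ _ _ fun v _ => ?_
  rw [integral_indicator_const _ (hmeas v), smul_eq_mul, mul_one]
  exact measureReal_coord_ge_le h0 hs (hv v) ht

/-! ### The maximum. -/

theorem integrable_iSup_coord [IsGaussian μ] : Integrable (fun x : V → ℝ => ⨆ v, x v) μ := by
  refine Integrable.mono' (IsGaussian.integrable_id (μ := μ)).norm
    (Measurable.iSup fun v => measurable_pi_apply v).aestronglyMeasurable (ae_of_all _ fun x => ?_)
  cases isEmpty_or_nonempty V
  · simp
  · rw [Real.norm_eq_abs, abs_le]
    obtain ⟨v⟩ := ‹Nonempty V›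
    refine ⟨?_, ciSup_le fun v => (le_abs_self _).trans (norm_le_pi_norm x v)⟩
    have h1 := (abs_le.mp (norm_le_pi_norm x v)).1
    exact h1.trans (le_ciSup (f := x) (Set.finite_range _).bddAbove v)

/-- The bound (u - t)⁺ ≤ exp(m(u - t))/m is applied at the maximizer, whose exponential is at most
the sum over all of V. -/
theorem integral_max_iSup_sub_le [Nonempty V] [IsGaussian μ] (h0 : ∀ v, ∫ x, x v ∂μ = 0)
    {s : ℝ} (hv : ∀ v, Var[fun x => x v; μ] ≤ s) {m : ℝ} (hm : 0 < m) (t : ℝ) :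
    ∫ x, max ((⨆ v, x v) - t) 0 ∂μ ≤ Fintype.card V * Real.exp (m ^ 2 * s / 2 - m * t) / m := by
  let L : V → StrongDual ℝ (V → ℝ) := fun v =>
    m • ContinuousLinearMap.proj (R := ℝ) (φ := fun _ : V => ℝ) v
  have hL : ∀ v x, L v x = m * x v := fun v x => by simp [L]
  have hint : Integrable (fun x => ∑ v, Real.exp (L v x) * (Real.exp (-(m * t)) / m)) μ :=
    integrable_finsetSum _ fun v _ => (integrable_exp_dual (L v)).mul_const _
  refine (integral_mono ((integrable_iSup_coord.sub (integrable_const t)).pos_part) hint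
    fun x => ?_).trans ?_
  · obtain ⟨w, hw⟩ := exists_eq_ciSup_of_finite (f := x)
    have h1 : Real.exp (L w x) * (Real.exp (-(m * t)) / m) ≤
        ∑ v, Real.exp (L v x) * (Real.exp (-(m * t)) / m) :=
      Finset.single_le_sum (f := fun v => Real.exp (L v x) * (Real.exp (-(m * t)) / m))
        (fun v _ => by positivity) (Finset.mem_univ w)
    refine le_trans ?_ h1
    change max ((⨆ v, x v) - t) 0 ≤ _
    rw [← hw, ← mul_div_assoc, ← Real.exp_add, hL]
    refine max_le ?_ (by positivity)
    rw [le_div_iff₀ hm]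
    have := Real.add_one_le_exp (m * x w + -(m * t))
    nlinarith
  · rw [integral_finsetSum _ fun v _ => (integrable_exp_dual (L v)).mul_const _, mul_div_assoc,
      ← nsmul_eq_mul]
    refine Finset.sum_le_card_nsmul _ _ _ fun v _ => ?_
    rw [integral_mul_const, integral_exp_dual h0, ← mul_div_assoc, ← Real.exp_add]
    have : Var[L v; μ] = m ^ 2 * Var[fun x => x v; μ] := by rw [← variance_const_mul]; simp [L]; rfl
    rw [this]
    gcongr
    have := mul_le_mul_of_nonneg_left (hv v) (sq_nonneg m)
    linarith

/-- A lower tail bound for the maximum, from its expectation and its exponential upper tail. -/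
theorem measureReal_iSup_lt_le [Nonempty V] [IsGaussian μ] (h0 : ∀ v, ∫ x, x v ∂μ = 0)
    {s : ℝ} (hv : ∀ v, Var[fun x => x v; μ] ≤ s) {m : ℝ} (hm : 0 < m) {t t' : ℝ} (htt : t' < t) :
    μ.real {x | ∀ v, x v < t'} ≤
      (Fintype.card V * Real.exp (m ^ 2 * s / 2 - m * t) / m + (t - ∫ x, ⨆ v, x v ∂μ)) /
        (t - t') := by
  have hI := integrable_iSup_coord (μ := μ)
  have hpos := (hI.sub (integrable_const t)).pos_part
  -- Once the excess above t has small mean, a maximum with mean close to t has a small mean deficit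
  -- below t; Markov's inequality finishes.
  have heq : ∀ x : V → ℝ, max (t - ⨆ v, x v) 0 = max ((⨆ v, x v) - t) 0 + (t - ⨆ v, x v) := by
    intro x
    rcases le_total t (⨆ v, x v) with h | h
    · rw [max_eq_right (by linarith), max_eq_left (by linarith)]; ring
    · rw [max_eq_left (by linarith), max_eq_right (by linarith)]; ring
  have hint : Integrable (fun x : V → ℝ => max (t - ⨆ v, x v) 0) μ :=
    ((integrable_const t).sub hI).pos_part
  have h := mul_meas_ge_le_integral_of_nonneg (μ := μ) (f := fun x => max (t - ⨆ v, x v) 0)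
    (ae_of_all _ fun x => le_max_right _ _) hint (t - t')
  rw [le_div_iff₀ (by linarith), mul_comm]
  refine (mul_le_mul_of_nonneg_left (measureReal_mono fun x hx => ?_) (by linarith)).trans
    (h.trans ?_)
  · obtain ⟨w, hw⟩ := exists_eq_ciSup_of_finite (f := x)
    have := hx w
    change t - t' ≤ max _ _
    rw [← hw]
    exact le_max_of_le_left (by linarith)
  · simp_rw [heq]
    rw [show ∫ x : V → ℝ, max ((⨆ v, x v) - t) 0 + (t - ⨆ v, x v) ∂μ =
        ∫ x : V → ℝ, max ((⨆ v, x v) - t) 0 ∂μ + ∫ x : V → ℝ, (t - ⨆ v, x v) ∂μ from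
      integral_add hpos ((integrable_const t).sub hI), integral_sub (integrable_const t) hI]
    simp only [integral_const, probReal_univ, one_smul]
    have := integral_max_iSup_sub_le h0 hv hm t
    linarith

/-! ### Two independent copies. -/

/-- Chernoff's bound for a half-plane intersection of two independent copies of the field. -/
theorem prod_measureReal_le_exp [IsGaussian μ] (h0 : ∀ v, ∫ x, x v ∂μ = 0)
    {s : ℝ} {v : V} (hv : Var[fun x => x v; μ] ≤ s) {p q c : ℝ} {S : Set ((V → ℝ) × (V → ℝ))}
    (hS : ∀ z ∈ S, c ≤ p * z.1 v + q * z.2 v) :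
    (μ.prod μ).real S ≤ Real.exp ((p ^ 2 + q ^ 2) * s / 2 - c) := by
  let L : ℝ → StrongDual ℝ (V → ℝ) := fun p =>
    p • ContinuousLinearMap.proj (R := ℝ) (φ := fun _ : V => ℝ) v
  have hL : ∀ p x, L p x = p * x v := fun p x => by simp [L]
  have hvar : ∀ p, Var[L p; μ] = p ^ 2 * Var[fun x => x v; μ] := fun p => by
    rw [← variance_const_mul]; simp [L]; rfl
  have heq : ∀ z : (V → ℝ) × (V → ℝ), Real.exp (p * z.1 v + q * z.2 v - c) =
      Real.exp (L p z.1) * Real.exp (L q z.2) * Real.exp (-c) := fun z => by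
    rw [hL, hL, ← Real.exp_add, ← Real.exp_add, sub_eq_add_neg]
  refine (measureReal_le_integral_exp (f := fun z => p * z.1 v + q * z.2 v - c) ?_ ?_).trans ?_
  · simp_rw [heq]
    exact ((integrable_exp_dual _).mul_prod (integrable_exp_dual _)).mul_const _
  · intro z hz
    linarith [hS z hz]
  · simp_rw [heq]
    rw [integral_mul_const, integral_prod_mul (fun x => Real.exp (L p x))
      (fun x => Real.exp (L q x)), integral_exp_dual h0, integral_exp_dual h0, hvar, hvar,
      ← Real.exp_add, ← Real.exp_add]
    apply Real.exp_le_exp.mpr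
    have := mul_le_mul_of_nonneg_left hv (add_nonneg (sq_nonneg p) (sq_nonneg q))
    linarith

theorem map_cos_add_sin_eq_self [IsGaussian μ] (h0 : ∀ v, ∫ x, x v ∂μ = 0) (φ : ℝ) :
    (μ.prod μ).map (fun z => Real.cos φ • z.1 + Real.sin φ • z.2) = μ := by
  have h := IsGaussian.map_rotation_eq_self_of_forall_strongDual_eq_zero (μ := μ)
    (integral_dual_eq_zero_of_coord h0) φ
  have h1 : (fun z : (V → ℝ) × (V → ℝ) => Real.cos φ • z.1 + Real.sin φ • z.2)
      = Prod.fst ∘ (ContinuousLinearMap.rotation φ) := by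
    ext z
    simp [ContinuousLinearMap.rotation_apply]
  rw [h1, ← Measure.map_map measurable_fst (by fun_prop), h, Measure.map_fst_prod]
  simp

/-- Two independent copies of the field have a common high point, in prescribed proportions. -/
theorem prod_measureReal_not_exists_pair_le [IsGaussian μ] (h0 : ∀ v, ∫ x, x v ∂μ = 0)
    {s : ℝ} (hv : ∀ v, Var[fun x => x v; μ] ≤ s) (φ m γ : ℝ) (hγ : 0 ≤ γ) (hm : 0 ≤ m) :
    (μ.prod μ).real {z | ¬ ∃ v, (Real.cos φ - γ) * (m * s) ≤ z.1 v ∧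
        (Real.sin φ - γ) * (m * s) ≤ z.2 v} ≤
      μ.real {x | ∀ v, x v < (1 - γ ^ 2 / 4) * (m * s)} +
        2 * (Fintype.card V * Real.exp (-(m ^ 2 * s * (1 / 2 + γ ^ 2 / 4)))) := by
  set a := Real.cos φ
  set b := Real.sin φ
  have hab : a ^ 2 + b ^ 2 = 1 := Real.cos_sq_add_sin_sq φ
  -- `A`: the rotated field is nowhere high. `B v`, `C v`: it is high at v although one of the
  -- copies falls short there.
  let A : Set ((V → ℝ) × (V → ℝ)) := {z | ∀ v, a * z.1 v + b * z.2 v < (1 - γ ^ 2 / 4) * (m * s)}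
  let B : V → Set ((V → ℝ) × (V → ℝ)) := fun v =>
    {z | (1 - γ ^ 2 / 4) * (m * s) ≤ a * z.1 v + b * z.2 v ∧ z.1 v < (a - γ) * (m * s)}
  let C : V → Set ((V → ℝ) × (V → ℝ)) := fun v =>
    {z | (1 - γ ^ 2 / 4) * (m * s) ≤ a * z.1 v + b * z.2 v ∧ z.2 v < (b - γ) * (m * s)}
  have hsub : {z : (V → ℝ) × (V → ℝ) | ¬ ∃ v, (a - γ) * (m * s) ≤ z.1 v ∧
      (b - γ) * (m * s) ≤ z.2 v} ⊆ A ∪ ((⋃ v, B v) ∪ ⋃ v, C v) := by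
    intro z hz
    by_cases hA : z ∈ A
    · exact Or.inl hA
    · right
      simp only [A, Set.mem_ofPred_eq, not_forall, not_lt] at hA
      obtain ⟨v, hA⟩ := hA
      by_cases h1 : z.1 v < (a - γ) * (m * s)
      · exact Or.inl (Set.mem_iUnion.mpr ⟨v, hA, h1⟩)
      · by_cases h2 : z.2 v < (b - γ) * (m * s)
        · exact Or.inr (Set.mem_iUnion.mpr ⟨v, hA, h2⟩)
        · exact absurd ⟨v, not_lt.mp h1, not_lt.mp h2⟩ hz
  have hA : (μ.prod μ).real A = μ.real {x | ∀ v, x v < (1 - γ ^ 2 / 4) * (m * s)} := by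
    conv_rhs => rw [← map_cos_add_sin_eq_self h0 φ]
    rw [map_measureReal_apply (by fun_prop)]
    · rfl
    · rw [Set.ofPred_forall]
      exact MeasurableSet.iInter fun v => measurableSet_lt (measurable_pi_apply v) measurable_const
  have hB : ∀ v, (μ.prod μ).real (B v) ≤ Real.exp (-(m ^ 2 * s * (1 / 2 + γ ^ 2 / 4))) := by
    intro v
    -- The tilt is m times the first constraint minus γm times the second. The exponent beats m²s/2,
    -- the cost of the union over V, by m²sγ²/4.
    refine (prod_measureReal_le_exp h0 (hv v) (p := m * (a - γ)) (q := m * b)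
      (c := m * ((1 - γ ^ 2 / 4) * (m * s)) - γ * m * ((a - γ) * (m * s))) ?_).trans_eq ?_
    · rintro z ⟨h1, h2⟩
      have h3 := mul_le_mul_of_nonneg_left h1 hm
      have h4 := mul_le_mul_of_nonneg_left h2.le (mul_nonneg hγ hm)
      linarith
    · congr 1
      linear_combination (m ^ 2 * s / 2) * hab
  have hC : ∀ v, (μ.prod μ).real (C v) ≤ Real.exp (-(m ^ 2 * s * (1 / 2 + γ ^ 2 / 4))) := by
    intro v
    refine (prod_measureReal_le_exp h0 (hv v) (p := m * a) (q := m * (b - γ))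
      (c := m * ((1 - γ ^ 2 / 4) * (m * s)) - γ * m * ((b - γ) * (m * s))) ?_).trans_eq ?_
    · rintro z ⟨h1, h2⟩
      have h3 := mul_le_mul_of_nonneg_left h1 hm
      have h4 := mul_le_mul_of_nonneg_left h2.le (mul_nonneg hγ hm)
      linarith
    · congr 1
      linear_combination (m ^ 2 * s / 2) * hab
  have hunion : ∀ D : V → Set ((V → ℝ) × (V → ℝ)),
      (∀ v, (μ.prod μ).real (D v) ≤ Real.exp (-(m ^ 2 * s * (1 / 2 + γ ^ 2 / 4)))) →
      (μ.prod μ).real (⋃ v, D v) ≤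
        Fintype.card V * Real.exp (-(m ^ 2 * s * (1 / 2 + γ ^ 2 / 4))) := by
    intro D hD
    refine (measureReal_iUnion_fintype_le _).trans ?_
    rw [← nsmul_eq_mul]
    exact Finset.sum_le_card_nsmul _ _ _ fun v _ => hD v
  have h1 := measureReal_mono (μ := μ.prod μ) hsub
  have h2 := measureReal_union_le (μ := μ.prod μ) A ((⋃ v, B v) ∪ ⋃ v, C v)
  have h3 := measureReal_union_le (μ := μ.prod μ) (⋃ v, B v) (⋃ v, C v)
  linarith [hunion B hB, hunion C hC]

/-- If every section over `B` misses at least half of the second space, then `B` is small. -/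
theorem measureReal_le_two_mul_prod {Ω Ω' : Type*} [MeasurableSpace Ω] [MeasurableSpace Ω']
    {P : Measure Ω} {Q : Measure Ω'} [IsProbabilityMeasure P] [IsProbabilityMeasure Q]
    {E : Set (Ω × Ω')} (hE : MeasurableSet E) {B : Set Ω}
    (h : ∀ x ∈ B, Q.real {y | (x, y) ∈ E} ≤ 1 / 2) :
    P.real B ≤ 2 * (P.prod Q).real Eᶜ := by
  have hsec : ∀ x ∈ B, (2 : ENNReal)⁻¹ ≤ Q (Prod.mk x ⁻¹' Eᶜ) := by
    intro x hx
    have hm : MeasurableSet (Prod.mk x ⁻¹' E) := measurable_prodMk_left hE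
    have h1 : Q.real (Prod.mk x ⁻¹' E)ᶜ = 1 - Q.real (Prod.mk x ⁻¹' E) := probReal_compl_eq_one_sub hm
    have h2 : Q.real (Prod.mk x ⁻¹' E) ≤ 1 / 2 := h x hx
    have h3 : (1 / 2 : ℝ) ≤ Q.real (Prod.mk x ⁻¹' Eᶜ) := by
      rw [Set.preimage_compl, h1]; linarith
    rw [← ENNReal.ofReal_toReal (measure_ne_top Q (Prod.mk x ⁻¹' Eᶜ))]
    have h4 : (2 : ENNReal)⁻¹ = ENNReal.ofReal (1 / 2) := by
      rw [one_div, ENNReal.ofReal_inv_of_pos (by norm_num)]; simp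
    rw [h4]
    exact ENNReal.ofReal_le_ofReal h3
  have hmain : (2 : ENNReal)⁻¹ * P B ≤ (P.prod Q) Eᶜ := by
    rw [Measure.prod_apply hE.compl]
    -- Markov's inequality for the section measure, on a measurable set containing `B`; `B` itself
    -- need not be measurable.
    refine le_trans ?_ (mul_meas_ge_le_lintegral (measurable_measure_prodMk_left hE.compl) 2⁻¹)
    gcongr
    exact hsec
  have := ENNReal.toReal_mono (measure_ne_top _ _) hmain
  rw [ENNReal.toReal_mul] at this
  simp only [ENNReal.toReal_inv, ENNReal.toReal_ofNat] at this
  simp only [Measure.real]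
  linarith

/-! ### Covering by correlation balls. -/

theorem variance_sub_const_mul {Ω : Type*} [MeasurableSpace Ω] {P : Measure Ω}
    [IsProbabilityMeasure P] {f g : Ω → ℝ}
    (hf : MemLp f 2 P) (hg : MemLp g 2 P) (k : ℝ) :
    Var[fun x => f x - k * g x; P] = Var[f; P] - 2 * k * cov[f, g; P] + k ^ 2 * Var[g; P] := by
  rw [variance_fun_sub hf (hg.const_mul k), variance_const_mul, covariance_const_mul_right]
  ring

/-- If `U` is covered by the `ε`-correlation balls around the points of `W`, the maximum of the
field over `U` behaves as if the variances were at most `(1 - ε ^ 2) s`. -/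
theorem measureReal_exists_coord_ge_le_of_cover [IsGaussian μ] (h0 : ∀ v, ∫ x, x v ∂μ = 0)
    {s t r ε : ℝ} (hs : 0 < s) (hv : ∀ v, Var[fun x => x v; μ] ≤ s) (hr : 0 ≤ r) (hrt : r ≤ t)
    (hε : 0 < ε) (hε1 : ε < 1) (U W : Finset V)
    (hcov : ∀ v ∈ U, v ∈ W ∨ ∃ w ∈ W,
      ε * Real.sqrt (Var[fun x => x v; μ] * Var[fun x => x w; μ]) < ∫ x, x v * x w ∂μ) :
    μ.real {x | ∃ v ∈ U, t ≤ x v} ≤ 2 * (W.card * Real.exp (-r ^ 2 / (2 * s))) +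
      W.card * (U.card * Real.exp (-(t - r) ^ 2 / (2 * (s * (1 - ε ^ 2))))) := by
  classical
  let σ : V → ℝ := fun v => Real.sqrt (Var[fun x => x v; μ])
  let pr : V → StrongDual ℝ (V → ℝ) := fun v =>
    ContinuousLinearMap.proj (R := ℝ) (φ := fun _ : V => ℝ) v
  have hmem : ∀ v, MemLp (fun x : V → ℝ => x v) 2 μ := fun v =>
    IsGaussian.memLp_dual μ (pr v) 2 (by simp)
  have hcovint : ∀ v w, cov[fun x => x v, fun x => x w; μ] = ∫ x, x v * x w ∂μ := fun v w => by
    rw [covariance_eq_sub (hmem v) (hmem w)]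
    simp [h0]
  have hσ2 : ∀ v, σ v ^ 2 = Var[fun x => x v; μ] := fun v => Real.sq_sqrt (variance_nonneg _ _)
  have hσ0 : ∀ v, 0 ≤ σ v := fun v => Real.sqrt_nonneg _
  have hσs : ∀ v, σ v ≤ Real.sqrt s := fun v => Real.sqrt_le_sqrt (hv v)
  -- `A`: a centre itself reaches t. `B`: a centre is large relative to its standard deviation. `C`:
  -- the residual at v is large. Outside `B` the subtracted multiple of x w is at most r.
  let A : V → Set (V → ℝ) := fun w => {x | t ≤ x w}
  let B : V → Set (V → ℝ) := fun w => if 0 < σ w then {x | r / Real.sqrt s * σ w ≤ x w} else ∅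
  let C : V → V → Set (V → ℝ) := fun w v =>
    if 0 < σ w ∧ ε * (σ v * σ w) < ∫ x, x v * x w ∂μ then
      {x | t - r ≤ x v - ε * σ v / σ w * x w} else ∅
  have hss : 0 < Real.sqrt s := Real.sqrt_pos.mpr hs
  have hsub : {x : V → ℝ | ∃ v ∈ U, t ≤ x v} ⊆
      ((⋃ w ∈ W, A w) ∪ ⋃ w ∈ W, B w) ∪ ⋃ w ∈ W, ⋃ v ∈ U, C w v := by
    rintro x ⟨v, hvU, hx⟩
    rcases hcov v hvU with hvW | ⟨w, hwW, hw⟩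
    · exact Or.inl (Or.inl (Set.mem_biUnion (by exact_mod_cast hvW) hx))
    · have hw' : ε * (σ v * σ w) < ∫ x, x v * x w ∂μ := by
        rwa [Real.sqrt_mul (variance_nonneg _ _)] at hw
      -- A centre of zero variance vanishes almost surely, so it cannot satisfy the strict
      -- correlation inequality.
      have hpos : 0 < σ w := by
        rcases (hσ0 w).lt_or_eq with h | h
        · exact h
        · exfalso
          have hz : Var[fun x => x w; μ] = 0 := by rw [← hσ2, ← h]; simp
          have hae := ae_eq_integral_of_variance_eq_zero (hmem w) hz
          have : ∫ x, x v * x w ∂μ = 0 := by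
            rw [integral_congr_ae (g := fun _ => 0)]
            · simp
            · filter_upwards [hae] with x hx
              have hx' : x w = 0 := by simpa [h0] using hx
              simp [hx']
          rw [this, ← h] at hw'
          simp at hw'
      by_cases hB : r / Real.sqrt s * σ w ≤ x w
      · refine Or.inl (Or.inr (Set.mem_biUnion (by exact_mod_cast hwW) ?_))
        simp only [B, if_pos hpos]
        exact hB
      · refine Or.inr (Set.mem_biUnion (by exact_mod_cast hwW)
          (Set.mem_biUnion (by exact_mod_cast hvU) ?_))
        simp only [C, if_pos (And.intro hpos hw')]
        change t - r ≤ x v - ε * σ v / σ w * x w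
        have h1 : ε * σ v / σ w * x w ≤ ε * σ v / σ w * (r / Real.sqrt s * σ w) :=
          mul_le_mul_of_nonneg_left (not_le.mp hB).le
            (div_nonneg (mul_nonneg hε.le (hσ0 v)) (hσ0 w))
        have h2 : ε * σ v / σ w * (r / Real.sqrt s * σ w) = ε * r * (σ v / Real.sqrt s) := by
          field_simp
        have h3 : σ v / Real.sqrt s ≤ 1 := (div_le_one hss).mpr (hσs v)
        have h4 : ε * r * (σ v / Real.sqrt s) ≤ 1 * r * 1 := by
          have := div_nonneg (hσ0 v) hss.le
          gcongr
        have hx' : t ≤ x v := hx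
        linarith
  have hA : ∀ w, μ.real (A w) ≤ Real.exp (-r ^ 2 / (2 * s)) := fun w => by
    refine (measureReal_coord_ge_le h0 hs (hv w) (hr.trans hrt)).trans ?_
    gcongr
  have hB : ∀ w, μ.real (B w) ≤ Real.exp (-r ^ 2 / (2 * s)) := fun w => by
    by_cases hw : 0 < σ w
    · simp only [B, if_pos hw]
      refine (measureReal_coord_ge_le h0 (s := σ w ^ 2) (by positivity) (hσ2 w).ge
        (by positivity)).trans_eq ?_
      congr 1
      rw [mul_pow, div_pow, Real.sq_sqrt hs.le]
      field_simp
    · simp only [B, if_neg hw]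
      simp [Real.exp_nonneg]
  have hε2 : 0 < 1 - ε ^ 2 := by nlinarith
  have hC : ∀ w v, μ.real (C w v) ≤ Real.exp (-(t - r) ^ 2 / (2 * (s * (1 - ε ^ 2)))) := by
    intro w v
    by_cases hw : 0 < σ w ∧ ε * (σ v * σ w) < ∫ x, x v * x w ∂μ
    · simp only [C, if_pos hw]
      refine measureReal_dual_ge_le h0 (pr v - (ε * σ v / σ w) • pr w)
        (mul_pos hs hε2) ?_ (by linarith)
      have heq : (⇑(pr v - (ε * σ v / σ w) • pr w) : (V → ℝ) → ℝ) =
          fun x => (fun x : V → ℝ => x v) x - (ε * σ v / σ w) * (fun x : V → ℝ => x w) x := by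
        ext x; simp [pr]
      rw [heq, variance_sub_const_mul (hmem v) (hmem w), hcovint, ← hσ2, ← hσ2]
      obtain ⟨hw0, hw1⟩ := hw
      -- The coefficient need not be the regression one: correlation above ε already gives residual
      -- variance at most σ_v²(1 - 2ε² + ε²).
      have h1 : (ε * σ v / σ w) * (ε * (σ v * σ w)) ≤ (ε * σ v / σ w) * ∫ x, x v * x w ∂μ :=
        mul_le_mul_of_nonneg_left hw1.le (div_nonneg (mul_nonneg hε.le (hσ0 v)) (hσ0 w))
      have h2 : (ε * σ v / σ w) * (ε * (σ v * σ w)) = ε ^ 2 * σ v ^ 2 := by field_simp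
      have h3 : (ε * σ v / σ w) ^ 2 * σ w ^ 2 = ε ^ 2 * σ v ^ 2 := by field_simp
      have h4 : σ v ^ 2 * (1 - ε ^ 2) ≤ s * (1 - ε ^ 2) :=
        mul_le_mul_of_nonneg_right ((hσ2 v).trans_le (hv v)) hε2.le
      rw [h3]
      linarith
    · simp only [C, if_neg hw]
      simp [Real.exp_nonneg]
  have hunion : ∀ (T : Finset V) (D : V → Set (V → ℝ)) (p : ℝ), (∀ v, μ.real (D v) ≤ p) →
      μ.real (⋃ v ∈ T, D v) ≤ T.card * p := fun T D p hD => by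
    refine (measureReal_biUnion_finset_le _ _).trans ?_
    rw [← nsmul_eq_mul]
    exact Finset.sum_le_card_nsmul _ _ _ fun v _ => hD v
  have h1 := measureReal_mono (μ := μ) hsub
  have h2 := measureReal_union_le (μ := μ) ((⋃ w ∈ W, A w) ∪ ⋃ w ∈ W, B w)
    (⋃ w ∈ W, ⋃ v ∈ U, C w v)
  have h3 := measureReal_union_le (μ := μ) (⋃ w ∈ W, A w) (⋃ w ∈ W, B w)
  linarith [hunion W A _ hA, hunion W B _ hB,
    hunion W (fun w => ⋃ v ∈ U, C w v) _ fun w => hunion U (C w) _ (hC w)]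

end FiniteDimensional

/-! ### Asymptotics along an extremal sequence. -/

/-- The laws of an extremal sequence of fields, as centred Gaussian measures on `V n → ℝ`;
`m` stands for `√(2 log lam)`. -/
structure IsExtremalLaw {V : ℕ → Type*} [∀ n, Fintype (V n)] (μ : ∀ n, Measure (V n → ℝ))
    (m : ℝ) : Prop where
  gaussian : ∀ n, IsGaussian (μ n)
  mean_zero : ∀ n v, ∫ x, x v ∂μ n = 0
  variance_le : ∀ n, 1 ≤ n → ∀ v, Var[fun x => x v; μ n] ≤ n
  card_growth : Tendsto (fun n : ℕ => Real.log (Fintype.card (V n)) / n) atTop (𝓝 (m ^ 2 / 2))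
  max_growth : Tendsto (fun n : ℕ => (∫ x, ⨆ v, x v ∂μ n) / (n * m)) atTop (𝓝 1)
  pos : 0 < m

theorem tendsto_exp_mul_natCast {a : ℝ} (ha : a < 0) :
    Tendsto (fun n : ℕ => Real.exp (a * n)) atTop (𝓝 0) :=
  Real.tendsto_exp_atBot.comp (tendsto_natCast_atTop_atTop.const_mul_atTop_of_neg ha)

namespace IsExtremalLaw

variable {V : ℕ → Type*} [∀ n, Fintype (V n)] {μ : ∀ n, Measure (V n → ℝ)} {m : ℝ}

theorem eventually_log_card_le (h : IsExtremalLaw μ m) {c : ℝ} (hc : m ^ 2 / 2 < c) :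
    ∀ᶠ n : ℕ in atTop, Real.log (Fintype.card (V n)) ≤ c * n := by
  filter_upwards [h.card_growth.eventually_lt_const hc, eventually_gt_atTop 0] with n hn h0
  have h0' : (0 : ℝ) < n := by exact_mod_cast h0
  exact ((div_lt_iff₀ h0').mp hn).le

theorem eventually_le_log_card (h : IsExtremalLaw μ m) {c : ℝ} (hc : c < m ^ 2 / 2) :
    ∀ᶠ n : ℕ in atTop, c * n ≤ Real.log (Fintype.card (V n)) := by
  filter_upwards [h.card_growth.eventually_const_lt hc, eventually_gt_atTop 0] with n hn h0
  have h0' : (0 : ℝ) < n := by exact_mod_cast h0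
  exact ((lt_div_iff₀ h0').mp hn).le

theorem eventually_nonempty (h : IsExtremalLaw μ m) : ∀ᶠ n in atTop, Nonempty (V n) := by
  have hm := h.pos
  filter_upwards [h.card_growth.eventually_const_lt (show (0 : ℝ) < m ^ 2 / 2 by positivity)]
    with n hn
  by_contra hV
  rw [not_nonempty_iff] at hV
  simp at hn

theorem tendsto_card_mul_exp (h : IsExtremalLaw μ m) {c : ℝ} (hc : m ^ 2 / 2 < c) :
    Tendsto (fun n : ℕ => Fintype.card (V n) * Real.exp (-(c * n))) atTop (𝓝 0) := by
  obtain ⟨d, hd1, hd2⟩ := exists_between hc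
  refine squeeze_zero' (Eventually.of_forall fun n => by positivity) ?_
    (tendsto_exp_mul_natCast (a := d - c) (by linarith))
  filter_upwards [h.eventually_log_card_le hd1, h.eventually_nonempty] with n hn hV
  have hpos : (0 : ℝ) < Fintype.card (V n) := by exact_mod_cast Fintype.card_pos
  have : (Fintype.card (V n) : ℝ) ≤ Real.exp (d * n) := (Real.log_le_iff_le_exp hpos).mp hn
  calc (Fintype.card (V n) : ℝ) * Real.exp (-(c * n))
      ≤ Real.exp (d * n) * Real.exp (-(c * n)) := by gcongr
    _ = Real.exp ((d - c) * n) := by rw [← Real.exp_add]; ring_nf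

theorem eventually_max_le (h : IsExtremalLaw μ m) {τ : ℝ} (hτ : 0 < τ) :
    ∀ᶠ n : ℕ in atTop, ∫ x, ⨆ v, x v ∂μ n ≤ (1 + τ) * (m * n) := by
  filter_upwards [h.max_growth.eventually_lt_const (show 1 < 1 + τ by linarith),
    eventually_gt_atTop 0] with n hn h0
  have h0' : (0 : ℝ) < n := by exact_mod_cast h0
  have := (div_lt_iff₀ (mul_pos h0' h.pos)).mp hn
  linarith

theorem eventually_le_max (h : IsExtremalLaw μ m) {τ : ℝ} (hτ : 0 < τ) :
    ∀ᶠ n : ℕ in atTop, (1 - τ) * (m * n) ≤ ∫ x, ⨆ v, x v ∂μ n := by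
  filter_upwards [h.max_growth.eventually_const_lt (show 1 - τ < 1 by linarith),
    eventually_gt_atTop 0] with n hn h0
  have h0' : (0 : ℝ) < n := by exact_mod_cast h0
  have := (lt_div_iff₀ (mul_pos h0' h.pos)).mp hn
  linarith

/-- The maximum is at least `(1 - r) m n` with probability tending to one. -/
theorem tendsto_measureReal_forall_lt (h : IsExtremalLaw μ m) {r : ℝ} (hr : 0 < r) :
    Tendsto (fun n : ℕ => (μ n).real {x | ∀ v, x v < (1 - r) * (m * n)}) atTop (𝓝 0) := by
  have hm := h.pos
  refine tendsto_order.2 ⟨fun a ha => Eventually.of_forall fun n =>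
    ha.trans_le measureReal_nonneg, fun e he => ?_⟩
  -- With t = (1 + s)mn the bound tends to s/(s + r), which is below e by this choice.
  let s : ℝ := e * r / 2
  have hs : 0 < s := by positivity
  have hse : (0 / m * 0 + (1 + s - 1)) / (s + r) < e := by
    rw [div_lt_iff₀ (by positivity)]
    have : 2 * s = e * r := by simp only [s]; ring
    nlinarith
  have hlim : Tendsto (fun n : ℕ => (Fintype.card (V n) *
      Real.exp (-((m ^ 2 / 2 + s * m ^ 2) * n)) / m * (1 / (n * m)) +
        (1 + s - (∫ x, ⨆ v, x v ∂μ n) / (n * m))) / (s + r)) atTop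
      (𝓝 ((0 / m * 0 + (1 + s - 1)) / (s + r))) := by
    refine Tendsto.div_const (Tendsto.add (Tendsto.mul ?_ ?_) (h.max_growth.const_sub _)) _
    · refine Tendsto.div_const (h.tendsto_card_mul_exp ?_) _
      have : 0 < s * m ^ 2 := by positivity
      linarith
    · simp_rw [one_div]
      exact tendsto_inv_atTop_zero.comp (tendsto_natCast_atTop_atTop.atTop_mul_const hm)
  filter_upwards [hlim.eventually_lt_const hse, h.eventually_nonempty, eventually_gt_atTop 0]
    with n hn hV h0
  have := h.gaussian n
  have h0' : (0 : ℝ) < n := by exact_mod_cast h0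
  have hmn : 0 < m * n := by positivity
  refine (measureReal_iSup_lt_le (h.mean_zero n) (h.variance_le n h0) hm
    (t := (1 + s) * (m * n)) (by nlinarith)).trans_lt (lt_of_eq_of_lt ?_ hn)
  have hexp : m ^ 2 * n / 2 - m * ((1 + s) * (m * n)) = -((m ^ 2 / 2 + s * m ^ 2) * n) := by ring
  rw [hexp, show (1 + s) * (m * n) - (1 - r) * (m * n) = (s + r) * (m * n) by ring]
  have hsr : s + r ≠ 0 := by positivity
  field_simp

/-- Two independent copies of the field have a common high point with probability tending to
one. -/
theorem tendsto_prod_measureReal (h : IsExtremalLaw μ m) (φ : ℝ) {γ : ℝ} (hγ : 0 < γ) :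
    Tendsto (fun n : ℕ => ((μ n).prod (μ n)).real {z | ¬ ∃ v,
      (Real.cos φ - γ) * (m * n) ≤ z.1 v ∧ (Real.sin φ - γ) * (m * n) ≤ z.2 v}) atTop (𝓝 0) := by
  have hm := h.pos
  have hlim := (h.tendsto_measureReal_forall_lt (r := γ ^ 2 / 4) (by positivity)).add
    ((h.tendsto_card_mul_exp (c := m ^ 2 * (1 / 2 + γ ^ 2 / 4))
      (by have : 0 < m ^ 2 * γ ^ 2 := by positivity
          linarith)).const_mul 2)
  rw [mul_zero, add_zero] at hlim
  refine squeeze_zero' (Eventually.of_forall fun n => measureReal_nonneg) ?_ hlim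
  filter_upwards [eventually_gt_atTop 0] with n h0
  have := h.gaussian n
  refine (prod_measureReal_not_exists_pair_le (h.mean_zero n) (h.variance_le n h0) φ m γ hγ.le
    hm.le).trans_eq ?_
  rw [mul_right_comm (m ^ 2)]

/-- Fubini turns the common high point of two copies into a statement about one: configurations for
which the other copy has at most an even chance of producing such a point are negligible. Both lower
bounds, for level sets and for valleys, take their bad event as `B`. -/
theorem tendsto_measureReal_of_section (h : IsExtremalLaw μ m) (φ : ℝ) {γ : ℝ} (hγ : 0 < γ)
    {B : ∀ n, Set (V n → ℝ)}
    (hB : ∀ᶠ n : ℕ in atTop, ∀ x ∈ B n, (μ n).real {y | ∃ v,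
      (Real.cos φ - γ) * (m * n) ≤ x v ∧ (Real.sin φ - γ) * (m * n) ≤ y v} ≤ 1 / 2) :
    Tendsto (fun n => (μ n).real (B n)) atTop (𝓝 0) := by
  have hlim := (h.tendsto_prod_measureReal φ hγ).const_mul 2
  rw [mul_zero] at hlim
  refine squeeze_zero' (Eventually.of_forall fun n => measureReal_nonneg) ?_ hlim
  filter_upwards [hB] with n hn
  have := h.gaussian n
  refine measureReal_le_two_mul_prod (P := μ n) (Q := μ n) (E := {z | ∃ v,
      (Real.cos φ - γ) * (m * n) ≤ z.1 v ∧ (Real.sin φ - γ) * (m * n) ≤ z.2 v}) ?_ hn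
  rw [Set.ofPred_exists]
  refine MeasurableSet.iUnion fun v => ?_
  exact MeasurableSet.inter
    (s₁ := {z : (V n → ℝ) × (V n → ℝ) | (Real.cos φ - γ) * (m * n) ≤ z.1 v})
    (s₂ := {z : (V n → ℝ) × (V n → ℝ) | (Real.sin φ - γ) * (m * n) ≤ z.2 v})
    (measurableSet_le measurable_const (by fun_prop))
    (measurableSet_le measurable_const (by fun_prop))

/-! ### Size of level sets. -/

/-- Take cos φ = α + 2γ and let γ decrease to 0, so that sin φ tends to √(1 - α²). The factor 1 + γ
absorbs the error in the expected maximum. -/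
theorem exists_angle_level {α r : ℝ} (hα : 0 < α) (hα1 : α < 1) (hr : 0 < r) :
    ∃ φ γ : ℝ, 0 < γ ∧ α * (1 + γ) ≤ Real.cos φ - γ ∧ 0 ≤ Real.sin φ - γ ∧
      1 - α ^ 2 - r < (Real.sin φ - γ) ^ 2 := by
  have hcont : ContinuousAt (fun γ : ℝ => Real.sin (Real.arccos (α + 2 * γ)) - γ) 0 := by
    have := Real.continuous_arccos
    fun_prop
  have hs : Real.sin (Real.arccos (α + 2 * 0)) - 0 = Real.sqrt (1 - α ^ 2) := by
    simp [Real.sin_arccos]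
  have hα2 : 0 < 1 - α ^ 2 := by nlinarith
  have h1 : ∀ᶠ γ in 𝓝[>] (0 : ℝ), 0 < Real.sin (Real.arccos (α + 2 * γ)) - γ := by
    refine (hcont.eventually (lt_mem_nhds ?_)).filter_mono nhdsWithin_le_nhds
    beta_reduce
    rw [hs]
    exact Real.sqrt_pos.mpr hα2
  have h2 : ∀ᶠ γ in 𝓝[>] (0 : ℝ),
      1 - α ^ 2 - r < (Real.sin (Real.arccos (α + 2 * γ)) - γ) ^ 2 := by
    refine ((hcont.pow 2).eventually (lt_mem_nhds ?_)).filter_mono nhdsWithin_le_nhds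
    simp only [Pi.pow_apply]
    rw [hs, Real.sq_sqrt hα2.le]
    linarith
  have h3 : ∀ᶠ γ in 𝓝[>] (0 : ℝ), γ < (1 - α) / 2 :=
    (gt_mem_nhds (by linarith)).filter_mono nhdsWithin_le_nhds
  obtain ⟨γ, h1, h2, h3, h4⟩ := (h1.and (h2.and (h3.and self_mem_nhdsWithin))).exists
  have h4 : 0 < γ := h4
  refine ⟨Real.arccos (α + 2 * γ), γ, h4, ?_, h1.le, h2⟩
  rw [Real.cos_arccos (by linarith) (by linarith)]
  nlinarith

/-- The level set is not much smaller than predicted. -/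
theorem tendsto_measureReal_card_le (h : IsExtremalLaw μ m) {α r : ℝ} (hα : 0 < α) (hα1 : α < 1)
    (hr : 0 < r) :
    Tendsto (fun n : ℕ => (μ n).real {x | ((Finset.univ.filter fun v =>
      α * (∫ x, ⨆ v, x v ∂μ n) ≤ x v).card : ℝ) ≤
        Real.exp (m ^ 2 / 2 * (1 - α ^ 2 - r) * n)}) atTop (𝓝 0) := by
  have hm := h.pos
  obtain ⟨φ, γ, hγ, hc, hs, hsr⟩ := exists_angle_level hα hα1 hr
  -- If the level set of x is too small, a union bound over it stops y from reaching (sin φ - γ)mn: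
  -- its rate 1 - α² - r is below (sin φ - γ)².
  refine h.tendsto_measureReal_of_section φ hγ ?_
  have hneg : m ^ 2 / 2 * ((1 - α ^ 2 - r) - (Real.sin φ - γ) ^ 2) < 0 :=
    mul_neg_of_pos_of_neg (by positivity) (by linarith)
  filter_upwards [h.eventually_max_le hγ, eventually_gt_atTop 0,
    (tendsto_exp_mul_natCast hneg).eventually_lt_const (show (0 : ℝ) < 1 / 2 by norm_num)]
    with n hg h0 hsmall x hx
  have := h.gaussian n
  have h0' : (0 : ℝ) < n := by exact_mod_cast h0
  have hmn : 0 < m * n := by positivity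
  have hx' : ((Finset.univ.filter fun v => α * (∫ x, ⨆ v, x v ∂μ n) ≤ x v).card : ℝ) ≤
        Real.exp (m ^ 2 / 2 * (1 - α ^ 2 - r) * n) := hx
  have hle : α * ∫ x, ⨆ v, x v ∂μ n ≤ (Real.cos φ - γ) * (m * n) := by
    have h1 := mul_le_mul_of_nonneg_left hg hα.le
    have h2 := mul_le_mul_of_nonneg_right hc hmn.le
    linarith
  calc (μ n).real {y | ∃ v, (Real.cos φ - γ) * (m * n) ≤ x v ∧ (Real.sin φ - γ) * (m * n) ≤ y v}
      ≤ (μ n).real {y | ∃ v ∈ Finset.univ.filter fun v => α * (∫ x, ⨆ v, x v ∂μ n) ≤ x v,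
          (Real.sin φ - γ) * (m * n) ≤ y v} := by
        refine measureReal_mono ?_
        rintro y ⟨v, h1, h2⟩
        exact ⟨v, by simpa using hle.trans h1, h2⟩
    _ ≤ _ := measureReal_exists_coord_ge_le (h.mean_zero n) h0' (h.variance_le n h0)
        (by positivity) _
    _ ≤ Real.exp (m ^ 2 / 2 * (1 - α ^ 2 - r) * n) *
          Real.exp (-((Real.sin φ - γ) * (m * n)) ^ 2 / (2 * n)) := by gcongr
    _ = Real.exp (m ^ 2 / 2 * ((1 - α ^ 2 - r) - (Real.sin φ - γ) ^ 2) * n) := by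
        rw [← Real.exp_add]
        congr 1
        field_simp
        ring
    _ ≤ 1 / 2 := hsmall.le

/-- First moment and Markov. The threshold is left general because level sets use a multiple of the
expected maximum and valleys a multiple of mn. -/
theorem tendsto_measureReal_le_card_of_threshold (h : IsExtremalLaw μ m) {t : ℕ → ℝ} {a q : ℝ}
    (ha : 0 ≤ a) (ht : ∀ᶠ n : ℕ in atTop, a * (m * n) ≤ t n) (hq : 1 - a ^ 2 < q) :
    Tendsto (fun n : ℕ => (μ n).real {x | Real.exp (m ^ 2 / 2 * q * n) ≤
      ((Finset.univ.filter fun v => t n ≤ x v).card : ℝ)}) atTop (𝓝 0) := by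
  have hm := h.pos
  have hlim := h.tendsto_card_mul_exp (c := m ^ 2 / 2 * (a ^ 2 + q)) (by
    have : 0 < m ^ 2 / 2 * (a ^ 2 + q - 1) := mul_pos (by positivity) (by linarith)
    linarith)
  refine squeeze_zero' (Eventually.of_forall fun n => measureReal_nonneg) ?_ hlim
  filter_upwards [ht, eventually_gt_atTop 0] with n hn h0
  have := h.gaussian n
  have h0' : (0 : ℝ) < n := by exact_mod_cast h0
  have ha' : 0 ≤ a * (m * n) := by positivity
  refine (measureReal_card_ge_le (h.mean_zero n) h0' (h.variance_le n h0)
    (ha'.trans hn) (Real.exp_pos _)).trans ?_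
  rw [mul_div_assoc, ← Real.exp_sub]
  gcongr
  have h1 : (a * (m * n)) ^ 2 ≤ t n ^ 2 := by gcongr
  have h2 : -t n ^ 2 / (2 * n) ≤ -(a * (m * n)) ^ 2 / (2 * n) := by
    gcongr
  have h3 : -(a * (m * n)) ^ 2 / (2 * n) = -(m ^ 2 / 2 * a ^ 2 * n) := by field_simp
  linarith

/-- The level set is not much larger than predicted. -/
theorem tendsto_measureReal_le_card (h : IsExtremalLaw μ m) {α r : ℝ} (hα : 0 < α) (hα1 : α < 1)
    (hr : 0 < r) :
    Tendsto (fun n : ℕ => (μ n).real {x | Real.exp (m ^ 2 / 2 * (1 - α ^ 2 + r) * n) ≤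
      ((Finset.univ.filter fun v => α * (∫ x, ⨆ v, x v ∂μ n) ≤ x v).card : ℝ)})
      atTop (𝓝 0) := by
  let τ : ℝ := min (r / 4) (1 / 2)
  have hτ : 0 < τ := by positivity
  have hτ1 : τ ≤ 1 / 2 := min_le_right _ _
  have hτ2 : τ ≤ r / 4 := min_le_left _ _
  refine h.tendsto_measureReal_le_card_of_threshold (a := α * (1 - τ))
    (mul_nonneg hα.le (by linarith)) ?_ ?_
  · filter_upwards [h.eventually_le_max hτ] with n hn
    have := mul_le_mul_of_nonneg_left hn hα.le
    linarith
  · have h1 : α ^ 2 * τ ≤ 1 * (r / 4) :=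
      mul_le_mul (by nlinarith) hτ2 hτ.le (by norm_num)
    nlinarith [sq_nonneg (α * τ)]

theorem tendsto_measureReal_log_card (h : IsExtremalLaw μ m) {α : ℝ} (hα : 0 < α) (hα1 : α < 1)
    {r : ℝ} (hr : 0 < r) :
    Tendsto (fun n : ℕ => (μ n).real {x | r ≤ |Real.log ((Finset.univ.filter fun v =>
      α * (∫ x, ⨆ v, x v ∂μ n) ≤ x v).card) / Real.log (Fintype.card (V n)) - (1 - α ^ 2)|})
      atTop (𝓝 0) := by
  have hm := h.pos
  have hm2 : 0 < m ^ 2 / 2 := by positivity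
  have hα2 : 0 < 1 - α ^ 2 := by nlinarith
  let q : ℝ := 1 - α ^ 2
  have hq1 : q < 1 := by simp only [q]; nlinarith
  -- The cap q/2 keeps q - s positive. Knowing log |V n| up to a factor 1 ± s/4 then costs at most
  -- half of the deviation s.
  let s : ℝ := min r (q / 2)
  have hs : 0 < s := by positivity
  have hsr : s ≤ r := min_le_left _ _
  have hsq : s ≤ q / 2 := min_le_right _ _
  have hlim := (h.tendsto_measureReal_card_le hα hα1 (half_pos hs)).add
    (h.tendsto_measureReal_le_card hα hα1 (half_pos hs))
  rw [add_zero] at hlim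
  refine squeeze_zero' (Eventually.of_forall fun n => measureReal_nonneg) ?_ hlim
  filter_upwards [h.eventually_log_card_le (c := m ^ 2 / 2 * (1 + s / 4)) (by nlinarith),
    h.eventually_le_log_card (c := m ^ 2 / 2 * (1 - s / 4)) (by nlinarith),
    eventually_gt_atTop 0] with n hle hge h0
  have := h.gaussian n
  have h0' : (0 : ℝ) < n := by exact_mod_cast h0
  refine (measureReal_mono fun x hx => ?_).trans (measureReal_union_le _ _)
  have hx' : r ≤ |Real.log ((Finset.univ.filter fun v =>
      α * (∫ x, ⨆ v, x v ∂μ n) ≤ x v).card) / Real.log (Fintype.card (V n)) - (1 - α ^ 2)| := hx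
  change ((Finset.univ.filter fun v => α * (∫ x, ⨆ v, x v ∂μ n) ≤ x v).card : ℝ) ≤ _ ∨
    _ ≤ ((Finset.univ.filter fun v => α * (∫ x, ⨆ v, x v ∂μ n) ≤ x v).card : ℝ)
  set k := (Finset.univ.filter fun v => α * (∫ x, ⨆ v, x v ∂μ n) ≤ x v).card
  -- An empty level set, where the logarithm takes its default value 0, falls into the "too small"
  -- event.
  rcases Nat.eq_zero_or_pos k with hk | hk
  · left
    rw [hk]
    simp [Real.exp_nonneg]
  have hk' : (0 : ℝ) < k := by exact_mod_cast hk
  have hmn : 0 < m ^ 2 / 2 * n := by positivity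
  have hVpos : 0 < Real.log (Fintype.card (V n)) := by
    have : 0 < m ^ 2 / 2 * (1 - s / 4) * n :=
      mul_pos (mul_pos hm2 (by linarith)) h0'
    linarith
  rcases le_abs.mp hx' with h1 | h1
  · right
    rw [← Real.le_log_iff_exp_le hk']
    have h2 : q + s ≤ Real.log k / Real.log (Fintype.card (V n)) := by linarith
    rw [le_div_iff₀ hVpos] at h2
    have h3 := mul_le_mul_of_nonneg_left hge (show 0 ≤ q + s by linarith)
    have h4 : 0 ≤ (m ^ 2 / 2 * n) * ((q + s) * (1 - s / 4) - (q + s / 2)) :=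
      mul_nonneg hmn.le (by nlinarith)
    linarith
  · left
    rw [← Real.log_le_iff_le_exp hk']
    have h2 : Real.log k / Real.log (Fintype.card (V n)) ≤ q - s := by linarith
    rw [div_le_iff₀ hVpos] at h2
    have h3 := mul_le_mul_of_nonneg_left hle (show 0 ≤ q - s by linarith)
    have h4 : 0 ≤ (m ^ 2 / 2 * n) * ((q - s / 2) - (q - s) * (1 + s / 4)) :=
      mul_nonneg hmn.le (by nlinarith)
    linarith

/-! ### Multiple valleys. -/

/-- First φ is made small so that m - m cos φ < δ, then τ tends to 0. At τ = 0 the last inequality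
reads sin² φ < sin² φ / (1 - ε²): the reduced variance leaves a strict gap between the size of the
level set and the residual tail. -/
theorem exists_angle_valley {m δ ε : ℝ} (hδ : 0 < δ) (hε : 0 < ε) (hε1 : ε < 1) :
    ∃ φ τ : ℝ, 0 < τ ∧ m * (1 + τ) - δ ≤ m * (Real.cos φ - τ) ∧ 0 ≤ Real.cos φ - τ ∧
      0 ≤ Real.sin φ - 2 * τ ∧
      τ ^ 2 / 2 + (1 - (Real.cos φ - τ) ^ 2 + τ) < (Real.sin φ - 2 * τ) ^ 2 / (1 - ε ^ 2) := by
  have hpi := Real.pi_pos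
  have hε2 : 0 < 1 - ε ^ 2 := by nlinarith
  obtain ⟨φ, hφδ, hφ2, hφ0⟩ : ∃ φ : ℝ, m - δ < m * Real.cos φ ∧ φ < Real.pi / 2 ∧ 0 < φ := by
    have h1 : ∀ᶠ φ in 𝓝[>] (0 : ℝ), m - δ < m * Real.cos φ := by
      have hc : ContinuousAt (fun φ => m * Real.cos φ) 0 := by fun_prop
      refine (hc.eventually (lt_mem_nhds ?_)).filter_mono nhdsWithin_le_nhds
      simpa using hδ
    have h2 : ∀ᶠ φ in 𝓝[>] (0 : ℝ), φ < Real.pi / 2 :=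
      (gt_mem_nhds (by positivity)).filter_mono nhdsWithin_le_nhds
    obtain ⟨φ, h1, h2, h3⟩ := (h1.and (h2.and self_mem_nhdsWithin)).exists
    exact ⟨φ, h1, h2, h3⟩
  have hcos : 0 < Real.cos φ := Real.cos_pos_of_mem_Ioo ⟨by linarith, hφ2⟩
  have hsin : 0 < Real.sin φ := Real.sin_pos_of_pos_of_lt_pi hφ0 (by linarith)
  have hev : ∀ f g : ℝ → ℝ, Continuous f → Continuous g → f 0 < g 0 →
      ∀ᶠ τ in 𝓝[>] (0 : ℝ), f τ < g τ := fun f g hf hg hfg =>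
    (hf.continuousAt.eventually_lt hg.continuousAt hfg).filter_mono nhdsWithin_le_nhds
  have h1 := hev (fun τ => m * (1 + τ) - δ) (fun τ => m * (Real.cos φ - τ)) (by fun_prop)
    (by fun_prop) (by simpa using hφδ)
  have h2 := hev (fun _ => 0) (fun τ => Real.cos φ - τ) (by fun_prop) (by fun_prop)
    (by simpa using hcos)
  have h3 := hev (fun _ => 0) (fun τ => Real.sin φ - 2 * τ) (by fun_prop) (by fun_prop)
    (by simpa using hsin)
  have h4 := hev (fun τ => τ ^ 2 / 2 + (1 - (Real.cos φ - τ) ^ 2 + τ))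
    (fun τ => (Real.sin φ - 2 * τ) ^ 2 / (1 - ε ^ 2)) (by fun_prop) (by fun_prop) (by
      have := Real.sin_sq_add_cos_sq φ
      have hs2 : 0 < Real.sin φ ^ 2 := by positivity
      simp only [sub_zero, mul_zero, add_zero]
      rw [lt_div_iff₀ hε2]
      have : 0 < ε ^ 2 * Real.sin φ ^ 2 := by positivity
      nlinarith)
  obtain ⟨τ, h1, h2, h3, h4, h5⟩ :=
    (h1.and (h2.and (h3.and (h4.and self_mem_nhdsWithin)))).exists
  exact ⟨φ, τ, h5, h1.le, h2.le, h3.le, h4⟩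

/-- A symmetric relation has, within any finite set, a maximal subset avoiding it. -/
theorem exists_maximal_avoiding {β : Type*} (R : β → β → Prop) (hR : ∀ u v, R u v → R v u)
    (U : Finset β) : ∃ W ⊆ U, (∀ u ∈ W, ∀ v ∈ W, u ≠ v → ¬ R u v) ∧
      ∀ v ∈ U, v ∈ W ∨ ∃ w ∈ W, R v w := by
  classical
  obtain ⟨W, hW, hmax⟩ := Finset.exists_max_image
    (U.powerset.filter fun W => ∀ u ∈ W, ∀ v ∈ W, u ≠ v → ¬ R u v) Finset.card
    ⟨∅, by simp⟩
  simp only [Finset.mem_filter, Finset.mem_powerset] at hW hmax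
  refine ⟨W, hW.1, hW.2, fun v hv => ?_⟩
  by_contra! hcon
  obtain ⟨hvW, hno⟩ := hcon
  have := hmax (insert v W) ⟨Finset.insert_subset hv hW.1, ?_⟩
  · rw [Finset.card_insert_of_notMem hvW] at this
    omega
  · intro a ha b hb hab
    rcases Finset.mem_insert.mp ha with ha' | ha' <;>
      rcases Finset.mem_insert.mp hb with hb' | hb'
    · exact absurd (ha'.trans hb'.symm) hab
    · exact ha' ▸ hno b hb'
    · exact fun hr => hno a ha' (hR _ _ (hb' ▸ hr))
    · exact hW.2 a ha' b hb' hab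

end IsExtremalLaw

theorem IsValleySet.mono {Ω V : Type*} [MeasurableSpace Ω] {P : Measure Ω} {X : V → Ω → ℝ}
    {n : ℕ} {c δ ε ε' : ℝ} {ω : Ω} {W : Finset V} (h : IsValleySet P X n c δ ε ω W)
    (hε : ε ≤ ε') : IsValleySet P X n c δ ε' ω W :=
  ⟨h.card_ge, fun u hu v hv huv => (h.nearly_orthogonal u hu v hv huv).trans
    (mul_le_mul_of_nonneg_right hε (Real.sqrt_nonneg _)), h.high⟩

/-- Multiple valleys for the laws of an extremal sequence. -/
theorem exists_valley_rate {m δ ε : ℝ} (hm : 0 < m) (hδ : 0 < δ) (hε : 0 < ε) :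
    ∃ c : ℝ, 0 < c ∧ ∀ (V : ℕ → Type*) [∀ n, Fintype (V n)] (μ : ∀ n, Measure (V n → ℝ)),
      IsExtremalLaw μ m → Tendsto (fun n => (μ n).real {x | ¬ ∃ W : Finset (V n),
        IsValleySet (μ n) (fun v x => x v) n c δ ε x W}) atTop (𝓝 0) := by
  -- For ε ≥ 1 the valleys obtained for 1/2 serve.
  wlog hε1 : ε < 1 generalizing ε
  · obtain ⟨c, hc, hmain⟩ := this (ε := 1 / 2) (by norm_num) (by norm_num)
    refine ⟨c, hc, fun V _ μ h => squeeze_zero (fun n => measureReal_nonneg) (fun n => ?_)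
      (hmain V μ h)⟩
    have := h.gaussian n
    refine measureReal_mono fun x hx => ?_
    rintro ⟨W, hW⟩
    exact hx ⟨W, hW.mono (by linarith)⟩
  obtain ⟨φ, τ, hτ, hhigh, hcos, hsin, hgap⟩ :=
    IsExtremalLaw.exists_angle_valley (m := m) hδ hε hε1
  have hε2 : 0 < 1 - ε ^ 2 := by nlinarith
  -- Half the rate m²τ²/2 at which a single point reaches τmn, so that with fewer than exp(cn)
  -- centres none of them matters.
  refine ⟨m ^ 2 / 2 * (τ ^ 2 / 2), by positivity, fun V _ μ h => ?_⟩
  set q : ℝ := 1 - (Real.cos φ - τ) ^ 2 + τ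
  let U : ∀ n, (V n → ℝ) → Finset (V n) := fun n x =>
    Finset.univ.filter fun v => (Real.cos φ - τ) * (m * n) ≤ x v
  have hmany : Tendsto (fun n : ℕ => (μ n).real {x | Real.exp (m ^ 2 / 2 * q * n) ≤
      ((U n x).card : ℝ)}) atTop (𝓝 0) :=
    h.tendsto_measureReal_le_card_of_threshold hcos (Eventually.of_forall fun n => le_rfl)
      (by simp only [q]; linarith)
  have hfew : Tendsto (fun n : ℕ => (μ n).real {x | (¬ ∃ W : Finset (V n),
      IsValleySet (μ n) (fun v x => x v) n (m ^ 2 / 2 * (τ ^ 2 / 2)) δ ε x W) ∧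
        ((U n x).card : ℝ) ≤ Real.exp (m ^ 2 / 2 * q * n)}) atTop (𝓝 0) := by
    refine h.tendsto_measureReal_of_section φ hτ ?_
    have hlim1 := tendsto_exp_mul_natCast (a := m ^ 2 / 2 * (τ ^ 2 / 2 - τ ^ 2))
      (mul_neg_of_pos_of_neg (by positivity) (by nlinarith))
    have hlim2 := tendsto_exp_mul_natCast
      (a := m ^ 2 / 2 * (τ ^ 2 / 2 + q - (Real.sin φ - 2 * τ) ^ 2 / (1 - ε ^ 2)))
      (mul_neg_of_pos_of_neg (by positivity) (by linarith))
    filter_upwards [h.eventually_max_le hτ, eventually_gt_atTop 0,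
      hlim1.eventually_lt_const (show (0 : ℝ) < 1 / 8 by norm_num),
      hlim2.eventually_lt_const (show (0 : ℝ) < 1 / 4 by norm_num)] with n hg h0 hs1 hs2 x hx
    obtain ⟨hnot, hcard⟩ := hx
    have := h.gaussian n
    have h0' : (0 : ℝ) < n := by exact_mod_cast h0
    have hmn : 0 < m * n := by positivity
    -- Near-orthogonality and height hold for W by construction, so it can fail to be a valley set
    -- only by being small; maximality makes it a cover.
    obtain ⟨W, hWU, hWorth, hWmax⟩ := IsExtremalLaw.exists_maximal_avoiding
      (fun u v : V n => ε * Real.sqrt (Var[fun x => x u; μ n] * Var[fun x => x v; μ n]) <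
        ∫ x, x u * x v ∂μ n) (fun u v huv => by
          simp_rw [mul_comm (_ : ℝ)] at huv ⊢
          simpa [mul_comm] using huv) (U n x)
    have hWcard : (W.card : ℝ) ≤ Real.exp (m ^ 2 / 2 * (τ ^ 2 / 2) * n) := by
      by_contra! hlt
      refine hnot ⟨W, hlt.le, fun u hu v hv huv => not_lt.mp (hWorth v hv u hu huv.symm),
        fun v hv => ?_⟩
      have h1 : (Real.cos φ - τ) * (m * n) ≤ x v := by
        simpa [U] using hWU hv
      have h2 : expMax (μ n) (fun v x => x v) ≤ (1 + τ) * (m * n) := hg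
      have h3 := mul_le_mul_of_nonneg_right hhigh h0'.le
      linarith
    -- Of the height (sin φ - τ)mn, a part τmn is conceded to the centres. The total is at most 2 ·
    -- 1/8 + 1/4 = 1/2.
    have hcover := measureReal_exists_coord_ge_le_of_cover (h.mean_zero n) h0'
      (h.variance_le n h0) (t := (Real.sin φ - τ) * (m * n)) (r := τ * (m * n))
      (by positivity) (mul_le_mul_of_nonneg_right (by linarith) hmn.le) hε hε1 (U n x) W hWmax
    have hset : {y : V n → ℝ | ∃ v, (Real.cos φ - τ) * (m * n) ≤ x v ∧
        (Real.sin φ - τ) * (m * n) ≤ y v} =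
        {y | ∃ v ∈ U n x, (Real.sin φ - τ) * (m * n) ≤ y v} := by
      ext y; simp [U]
    rw [hset]
    refine hcover.trans ?_
    have e1 : W.card * Real.exp (-(τ * (m * n)) ^ 2 / (2 * n)) ≤ 1 / 8 := by
      refine le_trans ?_ hs1.le
      calc W.card * Real.exp (-(τ * (m * n)) ^ 2 / (2 * n))
          ≤ Real.exp (m ^ 2 / 2 * (τ ^ 2 / 2) * n) *
            Real.exp (-(τ * (m * n)) ^ 2 / (2 * n)) := by gcongr
        _ = _ := by
          rw [← Real.exp_add]
          congr 1
          field_simp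
          ring
    have e2 : W.card * ((U n x).card * Real.exp (-((Real.sin φ - τ) * (m * n) -
        τ * (m * n)) ^ 2 / (2 * (n * (1 - ε ^ 2))))) ≤ 1 / 4 := by
      refine le_trans ?_ hs2.le
      calc W.card * ((U n x).card * Real.exp (-((Real.sin φ - τ) * (m * n) -
            τ * (m * n)) ^ 2 / (2 * (n * (1 - ε ^ 2)))))
          ≤ Real.exp (m ^ 2 / 2 * (τ ^ 2 / 2) * n) * (Real.exp (m ^ 2 / 2 * q * n) *
            Real.exp (-((Real.sin φ - τ) * (m * n) -
              τ * (m * n)) ^ 2 / (2 * (n * (1 - ε ^ 2))))) := by gcongr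
        _ = _ := by
          rw [← Real.exp_add, ← Real.exp_add]
          congr 1
          field_simp
          ring
    linarith
  have hlim := hfew.add hmany
  rw [add_zero] at hlim
  refine squeeze_zero (fun n => measureReal_nonneg) (fun n => ?_) hlim
  have := h.gaussian n
  refine (measureReal_mono fun x hx => ?_).trans (measureReal_union_le _ _)
  rcases le_total ((U n x).card : ℝ) (Real.exp (m ^ 2 / 2 * q * n)) with h1 | h1
  · exact Or.inl ⟨hx, h1⟩
  · exact Or.inr h1

/-! ### Transfer between a field and its law. -/

section Law

variable {Ω V : Type*} [MeasurableSpace Ω] [Fintype V] {P : Measure Ω} {X : V → Ω → ℝ}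

theorem IsCenteredGaussianField.isGaussian_law (h : IsCenteredGaussianField P X) :
    IsGaussian (P.map fun ω v => X v ω) := by
  let e : (↥(Finset.univ : Finset V) → ℝ) →L[ℝ] V → ℝ :=
    ContinuousLinearMap.pi fun v =>
      ContinuousLinearMap.proj (R := ℝ) (φ := fun _ : ↥(Finset.univ : Finset V) => ℝ)
        ⟨v, Finset.mem_univ v⟩
  exact ((h.gaussian.hasGaussianLaw Finset.univ).map e).isGaussian_map

theorem IsCenteredGaussianField.aemeasurable (h : IsCenteredGaussianField P X) :
    AEMeasurable (fun ω v => X v ω) P :=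
  aemeasurable_pi_iff.mpr fun v => h.gaussian.aemeasurable v

theorem IsCenteredGaussianField.integral_law (h : IsCenteredGaussianField P X)
    {f : (V → ℝ) → ℝ} (hf : Measurable f) :
    ∫ x, f x ∂(P.map fun ω v => X v ω) = ∫ ω, f (fun v => X v ω) ∂P :=
  integral_map h.aemeasurable hf.aestronglyMeasurable

theorem IsCenteredGaussianField.variance_law (h : IsCenteredGaussianField P X) (v : V) :
    Var[fun x => x v; P.map fun ω v => X v ω] = Var[X v; P] :=
  variance_map (X := fun x : V → ℝ => x v) (measurable_pi_apply v).aemeasurable h.aemeasurable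

theorem IsCenteredGaussianField.expMax_law (h : IsCenteredGaussianField P X) :
    ∫ x, ⨆ v, x v ∂(P.map fun ω v => X v ω) = expMax P X :=
  h.integral_law (Measurable.iSup fun v => measurable_pi_apply v)

theorem IsCenteredGaussianField.isValleySet_law (h : IsCenteredGaussianField P X) {n : ℕ}
    {c δ ε : ℝ} {ω : Ω} {W : Finset V}
    (hW : IsValleySet (P.map fun ω v => X v ω) (fun v x => x v) n c δ ε (fun v => X v ω) W) :
    IsValleySet P X n c δ ε ω W where
  card_ge := hW.card_ge
  nearly_orthogonal u hu v hv huv := by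
    have := hW.nearly_orthogonal u hu v hv huv
    rwa [h.integral_law (f := fun x => x v * x u) (by fun_prop), h.variance_law,
      h.variance_law] at this
  high v hv := by
    have := hW.high v hv
    rwa [expMax, h.expMax_law] at this

end Law

theorem IsExtremal.isExtremalLaw {Ω V : ℕ → Type*} [∀ n, MeasurableSpace (Ω n)]
    [∀ n, Fintype (V n)] {P : ∀ n, Measure (Ω n)} {η : ∀ n, V n → Ω n → ℝ} {lam : ℝ}
    (hlam : 1 < lam) (h : IsExtremal P η lam) :
    IsExtremalLaw (fun n => (P n).map fun ω v => η n v ω) (Real.sqrt (2 * Real.log lam)) where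
  gaussian n := (h.field n).isGaussian_law
  mean_zero n v := by
    rw [(h.field n).integral_law (measurable_pi_apply v)]
    exact (h.field n).mean_zero v
  variance_le n hn v := by
    rw [(h.field n).variance_law]
    exact h.variance_le n hn v
  card_growth := by
    have := Real.log_pos hlam
    rw [Real.sq_sqrt (by positivity), mul_div_cancel_left₀ _ two_ne_zero]
    exact h.card_growth
  max_growth := by
    simp_rw [fun n => (h.field n).expMax_law]
    exact h.expMax_growth
  pos := Real.sqrt_pos.mpr (mul_pos two_pos (Real.log_pos hlam))

/-- Smallness of an event transfers from the law of a field to the underlying space. -/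
theorem tendsto_measure_of_tendsto_law {Ω E : ℕ → Type*} [∀ n, MeasurableSpace (Ω n)]
    [∀ n, MeasurableSpace (E n)] {P : ∀ n, Measure (Ω n)} [∀ n, IsProbabilityMeasure (P n)]
    {Y : ∀ n, Ω n → E n} (hY : ∀ n, AEMeasurable (Y n) (P n)) {S : ∀ n, Set (E n)}
    (hS : Tendsto (fun n => ((P n).map (Y n)).real (S n)) atTop (𝓝 0)) :
    Tendsto (fun n => P n (Y n ⁻¹' S n)) atTop (𝓝 0) := by
  have h := ENNReal.tendsto_ofReal hS
  rw [ENNReal.ofReal_zero] at h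
  refine tendsto_of_tendsto_of_tendsto_of_le_of_le tendsto_const_nhds h (fun _ => zero_le)
    fun n => ?_
  have := Measure.isProbabilityMeasure_map (hY n)
  rw [ofReal_measureReal]
  -- This inequality holds for arbitrary sets, so the events need not be measurable.
  exact Measure.le_map_apply (hY n) _

theorem tendsto_measure_one_of_compl {Ω : ℕ → Type*} [∀ n, MeasurableSpace (Ω n)]
    {P : ∀ n, Measure (Ω n)} [∀ n, IsProbabilityMeasure (P n)] {S : ∀ n, Set (Ω n)}
    (hS : Tendsto (fun n => P n (S n)ᶜ) atTop (𝓝 0)) :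
    Tendsto (fun n => P n (S n)) atTop (𝓝 1) := by
  have h : Tendsto (fun n => 1 - P n (S n)ᶜ) atTop (𝓝 (1 - 0)) :=
    ENNReal.Tendsto.sub tendsto_const_nhds hS (Or.inl ENNReal.one_ne_top)
  rw [tsub_zero] at h
  refine tendsto_of_tendsto_of_tendsto_of_le_of_le h tendsto_const_nhds (fun n => ?_)
    fun n => prob_le_one
  rw [tsub_le_iff_right, ← measure_univ (μ := P n), ← Set.union_compl_self (S n)]
  exact measure_union_le _ _

/-- The constants `c δ ε` depend on `lam` (and on `δ, ε`) but not on the sequence of fields.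
In the second part `Real.log 0 = 0` is harmless: the limit `1 - α ^ 2` is positive, so the
convergence forces the level set to be nonempty with probability tending to one. -/
theorem theorem2 (lam : ℝ) (hlam : 1 < lam) :
    ∃ c : ℝ → ℝ → ℝ,
      ∀ (Ω V : ℕ → Type*) [∀ n, MeasurableSpace (Ω n)] [∀ n, Fintype (V n)]
        (P : ∀ n, Measure (Ω n)) [∀ n, IsProbabilityMeasure (P n)]
        (η : ∀ n, V n → Ω n → ℝ),
        IsExtremal P η lam →
          ExhibitsMultipleValleys P η c ∧
          ∀ α : ℝ, 0 < α → α < 1 →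
            TendstoInProbConst P
              (fun n ω => Real.log ((levelSet (P n) (η n) α ω).card) /
                Real.log (Fintype.card (V n)))
              (1 - α ^ 2) := by
  have hm : 0 < Real.sqrt (2 * Real.log lam) :=
    Real.sqrt_pos.mpr (mul_pos two_pos (Real.log_pos hlam))
  -- The rate is obtained before any fields are introduced, which gives the required uniformity.
  choose! c hc using fun δ ε : ℝ => fun (h : 0 < δ ∧ 0 < ε) => exists_valley_rate hm h.1 h.2
  refine ⟨c, fun Ω V _ _ P _ η h => ⟨fun δ ε hδ hε => ⟨(hc δ ε ⟨hδ, hε⟩).1, ?_⟩,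
    fun α hα hα1 r hr => ?_⟩⟩
  · refine tendsto_measure_one_of_compl (tendsto_of_tendsto_of_tendsto_of_le_of_le
      tendsto_const_nhds (tendsto_measure_of_tendsto_law (fun n => (h.field n).aemeasurable)
        ((hc δ ε ⟨hδ, hε⟩).2 V _ (h.isExtremalLaw hlam))) (fun _ => zero_le) fun n => ?_)
    refine measure_mono fun ω hω => ?_
    rintro ⟨W, hW⟩
    exact hω ⟨W, (h.field n).isValleySet_law hW⟩
  · have := tendsto_measure_of_tendsto_law (fun n => (h.field n).aemeasurable)
      ((h.isExtremalLaw hlam).tendsto_measureReal_log_card hα hα1 hr)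
    simp_rw [fun n => (h.field n).expMax_law] at this
    exact this
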